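/- Let $R$ be an associative ring with identity; all modules are unital. A left $R$-module $M$ is called square-free if there are no nonzero submodules $A, B \subseteq M$ with $A \cap B = 0$ and $A \cong B$. The socle of $M$ is the sum of all simple submodules of $M$ (and is $0$ if $M$ has no simple submodule); a module is cyclic if it is generated by one element, so the zero module is cyclic. Then the following statements are equivalent: (1) every injective left $R$-module is a direct sum of square-free modules; (2) every injective left $R$-module is a direct sum of modules with cyclic socle; (3) $R$ is left Noetherian. -/

import Mathlib

universe u v

namespace Module

universe w

variable (R : Type u) [Ring R]

/-- A left module is square-free if it contains no direct sum of two nonzero isomorphic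
submodules. -/
def IsSquareFree (M : Type w) [AddCommGroup M] [Module R M] : Prop :=
  ¬ ∃ A B : Submodule R M, A ≠ ⊥ ∧ B ≠ ⊥ ∧ Disjoint A B ∧ Nonempty (A ≃ₗ[R] B)

/-- The socle of a module: the sum of all its simple submodules (zero if there are none). -/
def socle (M : Type w) [AddCommGroup M] [Module R M] : Submodule R M :=
  sSup {S : Submodule R M | IsSimpleModule R S}

/-- The socle is cyclic, that is, generated by one element. The zero module is cyclic. -/
def HasCyclicSocle (M : Type w) [AddCommGroup M] [Module R M] : Prop :=
  (socle R M).IsPrincipal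

open Classical in
/-- `M` is the direct sum of a (possibly empty or infinite) family of submodules, each of which
has the property `P` as a module in its own right. -/
def IsDirectSumOf (P : ∀ (N : Type w) [AddCommGroup N] [Module R N], Prop)
    (M : Type w) [AddCommGroup M] [Module R M] : Prop :=
  ∃ (ι : Type w) (N : ι → Submodule R M), DirectSum.IsInternal N ∧ ∀ i, P (N i)

end Module

/-!
Suppose first that `R` is left Noetherian, and let `M` be injective. Direct sums of injective
modules are injective (`Module.Baer.dfinsupp`), every nonzero submodule contains a nonzero uniform
one (`Submodule.exists_isUniform_le`), and a maximal essential extension inside `M` of a submodule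
is injective (`Submodule.baer_of_maximal_isEssentialExtension`). Hence a maximal independent family
of injective uniform submodules of `M` has sum `M` (`Module.Baer.exists_sSupIndep_isUniform`). A
uniform module is square-free, and its socle is zero or simple, hence cyclic.

Conversely, in a square-free module `N`, as in a module `N` with cyclic socle, the `S`-isotypic
component is Noetherian for every simple `S`. Take an injective module `E` containing countably many
copies of `R ⧸ m` for every maximal left ideal `m`, and decompose it as a direct sum of such modules
`N i`. For each `m`, infinitely many `N i` receive a nonzero map from `R ⧸ m`: otherwise an infinite
direct sum of copies of `R ⧸ m` would embed into a finite product of Noetherian isotypic components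
(`DirectSum.IsInternal.infinite_setOf_exists_ne_zero`). Given a strictly ascending chain `I n` of
left ideals and `a n ∈ I (n + 1)` outside `I n`, there are therefore distinct indices `j n` and maps
`R → N (j n)` that kill `I n` but not `a n`. On the union of the chain they add up to a map into the
direct sum, which does not extend to `R`, since the image of `1` would have infinite support
(`isNoetherianRing_of_infinite_setOf_exists_ne_zero`). This contradicts the injectivity of `E`.

Injectivity is handled through Baer's criterion `Module.Baer`, which is insensitive to universe
levels.
-/

/-! ### Baer modules -/

section Baer

variable {R : Type*} [Ring R]

/-- A retract of an injective module is injective. -/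
theorem Module.Baer.of_retract {Q N : Type*} [AddCommGroup Q] [Module R Q] [AddCommGroup N]
    [Module R N] (hQ : Module.Baer R Q) (i : N →ₗ[R] Q) (r : Q →ₗ[R] N)
    (hri : ∀ x, r (i x) = x) : Module.Baer R N := fun I g ↦ by
  obtain ⟨g', hg'⟩ := hQ I (i ∘ₗ g)
  exact ⟨r ∘ₗ g', fun x hx ↦ by simp [hg' x hx, hri]⟩

/-- Over a left Noetherian ring, direct sums of injective modules are injective: a linear map from
a finitely generated left ideal to a direct sum has only finitely many nonzero components. -/
theorem Module.Baer.dfinsupp [IsNoetherianRing R] {ι : Type*} {Q : ι → Type*}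
    [∀ i, AddCommGroup (Q i)] [∀ i, Module R (Q i)] (hQ : ∀ i, Module.Baer R (Q i)) :
    Module.Baer R (Π₀ i, Q i) := fun I g ↦ by
  classical
  obtain ⟨s, hs⟩ := (inferInstance : IsNoetherian R I).noetherian ⊤
  let F : Finset ι := s.biUnion fun a ↦ (g a).support
  have hF : ∀ x : I, ∀ i ∉ F, g x i = 0 := fun x i hi ↦ by
    have hx : x ∈ Submodule.span R (s : Set I) := hs ▸ Submodule.mem_top
    induction hx using Submodule.span_induction with
    | mem x hx => exact by_contra fun h ↦ hi (Finset.mem_biUnion.2 ⟨x, hx, by simpa using h⟩)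
    | zero => simp
    | add x y _ _ hx hy => simp [hx, hy]
    | smul r x _ hx => simp [hx]
  choose g' hg' using fun i ↦ hQ i I (DFinsupp.lapply i ∘ₗ g)
  refine ⟨∑ i ∈ F, DFinsupp.lsingle i ∘ₗ g' i, fun x hx ↦ ?_⟩
  ext i
  by_cases hi : i ∈ F
  · simp [DFinsupp.single_apply, hi, hg' _ x hx]
  · have := hF ⟨x, hx⟩ i hi
    rw [this]
    simp [DFinsupp.single_apply, hi]

theorem Module.Baer.sSup_of_sSupIndep [IsNoetherianRing R] {M : Type*} [AddCommGroup M]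
    [Module R M] {s : Set (Submodule R M)} (hs : sSupIndep s)
    (hB : ∀ N ∈ s, Module.Baer R N) : Module.Baer R (sSup s : Submodule R M) := by
  classical
  have hinj := ((sSupIndep_iff s).1 hs).dfinsupp_lsum_injective
  have e := LinearEquiv.ofInjective _ hinj
  rw [← Submodule.iSup_eq_range_dfinsupp_lsum, ← sSup_eq_iSup'] at e
  exact (Module.Baer.dfinsupp fun N : s ↦ hB N N.2).of_equiv e

/-- If a direct sum of modules is injective, then a family of linear maps out of `R` which is
locally finite on a left ideal `I` has only finitely many members that do not vanish on `I`. -/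
theorem Module.Baer.finite_setOf_exists_ne_zero {ι : Type*} {Q : ι → Type*}
    [∀ i, AddCommGroup (Q i)] [∀ i, Module R (Q i)] (hQ : Module.Baer R (Π₀ i, Q i))
    (I : Ideal R) (g : ∀ i, R →ₗ[R] Q i) (hg : ∀ a ∈ I, {i | g i a ≠ 0}.Finite) :
    {i | ∃ a ∈ I, g i a ≠ 0}.Finite := by
  classical
  let G : I → Π₀ i, Q i := fun a ↦ DFinsupp.mk (hg a a.2).toFinset fun i ↦ g i a
  have hG : ∀ a i, G a i = g i a := fun a i ↦ by
    by_cases h : g i a = 0 <;> simp [G, DFinsupp.mk_apply, h]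
  obtain ⟨f, hf⟩ := hQ I
    { toFun := G
      map_add' := fun a b ↦ by ext i; simp [hG]
      map_smul' := fun r a ↦ by ext i; simpa [hG] using (g i).map_smul r a }
  refine (f 1).support.finite_toSet.subset ?_
  rintro i ⟨a, ha, hne⟩
  have h1 : f a = a • f 1 := by rw [← map_smul, smul_eq_mul, mul_one]
  have h2 : f a i = g i a := by rw [hf a ha]; exact hG ⟨a, ha⟩ i
  simp only [Finset.mem_coe, DFinsupp.mem_support_iff]
  intro h0
  exact hne (by rw [← h2, h1, DFinsupp.smul_apply, h0, smul_zero])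

end Baer

/-! ### Uniform submodules and essential extensions -/

section Uniform

variable {R : Type*} [Ring R] {M : Type*} [AddCommGroup M] [Module R M]

/-- A submodule is uniform if any two of its nonzero submodules meet nontrivially. The zero
submodule is uniform under this convention. -/
def Submodule.IsUniform (U : Submodule R M) : Prop :=
  ∀ A ≤ U, ∀ B ≤ U, Disjoint A B → A = ⊥ ∨ B = ⊥

/-- `H` is an essential extension of `U`: it contains `U`, and every nonzero submodule of `H`
meets `U` nontrivially. -/
def Submodule.IsEssentialExtension (U H : Submodule R M) : Prop :=
  U ≤ H ∧ ∀ A ≤ H, Disjoint U A → A = ⊥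

theorem Submodule.IsEssentialExtension.isUniform {U H : Submodule R M}
    (h : U.IsEssentialExtension H) (hU : U.IsUniform) : H.IsUniform := fun A hA B hB hAB ↦ by
  rcases hU (U ⊓ A) inf_le_left (U ⊓ B) inf_le_left (hAB.mono inf_le_right inf_le_right)
    with h0 | h0
  · exact .inl (h.2 A hA (disjoint_iff.2 h0))
  · exact .inr (h.2 B hB (disjoint_iff.2 h0))

theorem Submodule.map_subtype_eq_bot_iff {U : Submodule R M} {A : Submodule R U} :
    A.map U.subtype = ⊥ ↔ A = ⊥ := by
  rw [← (Submodule.map_injective_of_injective U.subtype_injective).eq_iff, Submodule.map_bot]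

theorem Submodule.IsUniform.eq_bot_or_eq_bot {U : Submodule R M} (hU : U.IsUniform)
    {A B : Submodule R U} (hAB : Disjoint A B) : A = ⊥ ∨ B = ⊥ := by
  simpa only [Submodule.map_subtype_eq_bot_iff] using
    hU (A.map U.subtype) (U.map_subtype_le A) (B.map U.subtype) (U.map_subtype_le B)
      (Submodule.disjoint_map U.subtype_injective hAB)

/-- Over a left Noetherian ring every nonzero submodule contains a nonzero uniform one: in a nonzero
cyclic submodule, let `B` be maximal among the submodules that meet some nonzero submodule `A`
trivially; then such an `A` is uniform. -/
theorem Submodule.exists_isUniform_le [IsNoetherianRing R] {C : Submodule R M} (hC : C ≠ ⊥) :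
    ∃ U ≤ C, U ≠ ⊥ ∧ U.IsUniform := by
  obtain ⟨x, hxC, hx0⟩ := C.exists_mem_ne_zero_of_ne_bot hC
  let D := Submodule.span R {x}
  have hD : D ≠ ⊥ := by simpa [D] using hx0
  have hDC : D ≤ C := by simpa [D] using hxC
  let S : Set (Submodule R D) := {B | ∃ A, A ≠ ⊥ ∧ Disjoint B A}
  have hS : S.Nonempty := ⟨⊥, ⊤, by
    have := Submodule.nontrivial_iff_ne_bot.2 hD
    exact top_ne_bot, disjoint_bot_left⟩
  obtain ⟨B, ⟨A, hA, hBA⟩, hmax⟩ := wellFounded_gt.has_min S hS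
  refine ⟨A.map D.subtype, (D.map_subtype_le A).trans hDC,
    Submodule.map_subtype_eq_bot_iff.not.2 hA, fun A₁ h₁ A₂ h₂ h₁₂ ↦ ?_⟩
  rw [or_iff_not_imp_right]
  intro hA₂
  obtain ⟨A₁, rfl⟩ : ∃ A', A'.map D.subtype = A₁ :=
    ⟨A₁.comap D.subtype, by simpa using h₁.trans (D.map_subtype_le A)⟩
  obtain ⟨A₂, rfl⟩ : ∃ A', A'.map D.subtype = A₂ :=
    ⟨A₂.comap D.subtype, by simpa using h₂.trans (D.map_subtype_le A)⟩
  rw [Submodule.map_le_map_iff_of_injective D.subtype_injective] at h₁ h₂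
  rw [disjoint_iff, ← Submodule.map_inf _ D.subtype_injective,
    Submodule.map_subtype_eq_bot_iff, ← disjoint_iff] at h₁₂
  rw [Submodule.map_subtype_eq_bot_iff] at hA₂ ⊢
  -- `B ⊔ A₁` misses the nonzero `A₂`, so `A₁ ≤ B` by maximality, while `B` and `A` are disjoint.
  have hdis : Disjoint (B ⊔ A₁) A₂ :=
    Disjoint.disjoint_sup_left_of_disjoint_sup_right h₁₂ (hBA.mono_right (sup_le h₁ h₂))
  have hle : A₁ ≤ B := by
    have h := hmax (B ⊔ A₁) ⟨A₂, hA₂, hdis⟩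
    rwa [left_lt_sup, not_not] at h
  exact disjoint_self.1 (hBA.mono hle h₁)

theorem Submodule.exists_maximal_isEssentialExtension (U : Submodule R M) :
    ∃ H, Maximal U.IsEssentialExtension H := by
  suffices h : ∀ c ⊆ {H | U.IsEssentialExtension H}, IsChain (· ≤ ·) c → ∀ H₀ ∈ c,
      ∃ ub ∈ {H | U.IsEssentialExtension H}, ∀ z ∈ c, z ≤ ub from
    (zorn_le_nonempty₀ _ h U ⟨le_rfl, fun A hA hUA ↦ hUA.eq_bot_of_ge hA⟩).imp fun _ ↦ And.right
  refine fun c hc hchain H₀ hH₀ ↦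
    ⟨sSup c, ⟨(hc hH₀).1.trans (le_sSup hH₀), fun A hA hUA ↦ ?_⟩, fun _ ↦ le_sSup⟩
  rw [Submodule.eq_bot_iff]
  intro a ha
  obtain ⟨H, hHc, haH⟩ :=
    (Submodule.mem_sSup_of_directed ⟨H₀, hH₀⟩ hchain.directedOn).1 (hA ha)
  have := (hc hHc).2 (Submodule.span R {a}) (by simpa using haH)
    (hUA.mono_right (by simpa using ha))
  simpa using this

theorem Submodule.exists_maximal_disjoint (H : Submodule R M) :
    ∃ K, Maximal (Disjoint H) K := by
  obtain ⟨K, hK⟩ := zorn_le₀ {K | Disjoint H K} fun c hc hchain ↦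
    ⟨sSup c, hchain.directedOn.disjoint_sSup_right.2 fun _ h ↦ hc h, fun _ ↦ le_sSup⟩
  exact ⟨K, hK⟩

/-- A maximal essential extension inside an injective module is a direct summand. With `K` maximal
among the submodules meeting `H` trivially, an endomorphism of `M` that is the identity on `H` and
vanishes on `K` has an image essential over `H`, hence equal to `H`. -/
theorem Submodule.baer_of_maximal_isEssentialExtension (hM : Module.Baer R M)
    {U H : Submodule R M} (hH : Maximal U.IsEssentialExtension H) : Module.Baer R H := by
  obtain ⟨K, hK⟩ := H.exists_maximal_disjoint
  obtain ⟨g, hg⟩ := hM.extension_property (K.mkQ ∘ₗ H.subtype) (by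
    rw [← LinearMap.ker_eq_bot, LinearMap.ker_comp, Submodule.ker_mkQ,
      ← Submodule.disjoint_iff_comap_eq_bot]
    exact hK.prop) H.subtype
  let h : M →ₗ[R] M := g ∘ₗ K.mkQ
  have hid : ∀ x ∈ H, h x = x := fun x hx ↦ congr($hg ⟨x, hx⟩)
  have hKker : K ≤ LinearMap.ker h := fun x hx ↦ by simp [h, (Submodule.Quotient.mk_eq_zero K).2 hx]
  have hHr : H ≤ LinearMap.range h := fun x hx ↦ ⟨x, hid x hx⟩
  have hess : U.IsEssentialExtension (LinearMap.range h) := by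
    refine ⟨hH.prop.1.trans hHr, fun A hA hUA ↦ ?_⟩
    have hHA : Disjoint H A := disjoint_iff.2 <|
      hH.prop.2 _ inf_le_left (hUA.mono_right inf_le_right)
    have hdis : Disjoint H (A.comap h) := by
      rw [Submodule.disjoint_def] at hHA ⊢
      exact fun x hx hxA ↦ hHA x hx (by simpa [hid x hx] using hxA)
    have hle : A.comap h ≤ K :=
      hK.le_of_ge hdis (hKker.trans (LinearMap.ker_le_comap h))
    rw [Submodule.eq_bot_iff]
    intro a ha
    obtain ⟨x, rfl⟩ := hA ha
    exact hKker (hle ha)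
  exact hM.of_retract H.subtype
    (h.codRestrict H fun x ↦ hH.le_of_ge hess hHr ⟨x, rfl⟩) fun x ↦ Subtype.ext (hid x x.2)

theorem sSupIndep.insert {α : Type*} [CompleteLattice α] [IsModularLattice α] {s : Set α} {a : α}
    (hs : sSupIndep s) (ha : Disjoint a (sSup s)) : sSupIndep (insert a s) := by
  intro x hx
  by_cases hxa : x = a
  · subst hxa
    exact ha.mono_right (sSup_le_sSup (by simp))
  have hxs : x ∈ s := hx.resolve_left hxa
  have hle : sSup (Insert.insert a s \ {x}) ≤ a ⊔ sSup (s \ {x}) := by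
    refine sSup_le ?_
    rintro y ⟨rfl | hy, hyx⟩
    · exact le_sup_left
    · exact (le_sSup (show y ∈ s \ {x} from ⟨hy, hyx⟩)).trans le_sup_right
  refine Disjoint.mono_right hle ?_
  rw [sup_comm]
  exact (hs hxs).disjoint_sup_right_of_disjoint_sup_left
    (ha.symm.mono_left (sup_le (le_sSup hxs) (sSup_le_sSup Set.sdiff_subset)))

/-- Matlis' theorem: over a left Noetherian ring, every injective module is a direct sum of uniform
submodules. The sum of a maximal independent family of injective uniform submodules is injective,
hence has a complement; a nonzero uniform submodule of the complement has a maximal essential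
extension by which the family could be enlarged. -/
theorem Module.Baer.exists_sSupIndep_isUniform [IsNoetherianRing R] (hM : Module.Baer R M) :
    ∃ s : Set (Submodule R M), sSupIndep s ∧ sSup s = ⊤ ∧ ∀ N ∈ s, N.IsUniform := by
  obtain ⟨s, hs⟩ := zorn_subset
    {s : Set (Submodule R M) | sSupIndep s ∧ ∀ N ∈ s, N.IsUniform ∧ Module.Baer R N}
    fun c hc hchain ↦ ⟨⋃₀ c, ⟨iSupIndep_sUnion_of_directed hchain.directedOn fun t ht ↦ (hc ht).1,
      fun N ⟨t, ht, hN⟩ ↦ (hc ht).2 N hN⟩, fun _ ↦ Set.subset_sUnion_of_mem⟩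
  refine ⟨s, hs.prop.1, ?_, fun N hN ↦ (hs.prop.2 N hN).1⟩
  obtain ⟨r, hr⟩ := (Module.Baer.sSup_of_sSupIndep hs.prop.1 fun N hN ↦
    (hs.prop.2 N hN).2).extension_property (sSup s).subtype (Submodule.subtype_injective _) .id
  have hcompl : IsCompl (sSup s) (LinearMap.ker r) :=
    LinearMap.isCompl_of_proj fun x ↦ congr($hr x)
  by_contra hne
  obtain ⟨U, hUC, hU0, hU⟩ := Submodule.exists_isUniform_le (C := LinearMap.ker r) fun h ↦
    hne (by simpa [h] using hcompl.sup_eq_top)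
  obtain ⟨H, hH⟩ := U.exists_maximal_isEssentialExtension
  -- `H` need not lie in the complement, but it meets `sSup s` trivially because `U` does.
  have hdis : Disjoint H (sSup s) := disjoint_iff.2 <| hH.prop.2 _ inf_le_left <|
    (hcompl.disjoint.symm.mono_left hUC).mono_right inf_le_right
  have hHs : H ∈ s := hs.le_of_ge ⟨hs.prop.1.insert hdis, by
    rintro N (rfl | hN)
    exacts [⟨hH.prop.isUniform hU, Submodule.baer_of_maximal_isEssentialExtension hM hH⟩,
      hs.prop.2 N hN]⟩ (Set.subset_insert _ _) (Set.mem_insert _ _)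
  exact hU0 (le_bot_iff.1 (hH.prop.1.trans (hdis.eq_bot_of_le (le_sSup hHs)).le))

theorem Submodule.IsUniform.isSquareFree {U : Submodule R M} (hU : U.IsUniform) :
    Module.IsSquareFree R U := by
  rintro ⟨A, B, hA, hB, hAB, -⟩
  exact (hU.eq_bot_or_eq_bot hAB).elim hA hB

/-- A uniform module has at most one simple submodule. -/
theorem Submodule.IsUniform.hasCyclicSocle {U : Submodule R M} (hU : U.IsUniform) :
    Module.HasCyclicSocle R U := by
  unfold Module.HasCyclicSocle Module.socle
  rcases Set.eq_empty_or_nonempty {S : Submodule R U | IsSimpleModule R S} with h | ⟨S, hS⟩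
  · rw [h, sSup_empty]
    infer_instance
  have hS' : IsAtom S := isSimpleModule_iff_isAtom.1 hS
  have : sSup {S : Submodule R U | IsSimpleModule R S} = S := by
    refine le_antisymm (sSup_le fun T hT ↦ ?_) (le_sSup hS)
    have hT' : IsAtom T := isSimpleModule_iff_isAtom.1 hT
    by_contra hne
    have hdis : Disjoint T S := hT'.not_le_iff_disjoint.1 hne
    exact (hU.eq_bot_or_eq_bot hdis).elim hT'.1 hS'.1
  rw [this]
  obtain ⟨x, hx, hx0⟩ := S.exists_mem_ne_zero_of_ne_bot hS'.1
  exact ⟨x, ((hS'.le_iff.1 (by simpa using hx)).resolve_left (by simpa using hx0)).symm⟩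

end Uniform

/-! ### Isotypic components of the summands -/

section Isotypic

variable {R : Type*} [Ring R]

theorem Module.IsSquareFree.isNoetherian_isotypicComponent {N S : Type*} [AddCommGroup N]
    [Module R N] [AddCommGroup S] [Module R S] [IsSimpleModule R S]
    (hN : Module.IsSquareFree R N) : IsNoetherian R (isotypicComponent R N S) := by
  -- Two distinct submodules isomorphic to `S` would be simple, hence disjoint.
  have hsub : {m : Submodule R N | Nonempty (m ≃ₗ[R] S)}.Subsingleton := by
    rintro A ⟨e⟩ B ⟨f⟩
    have hA : IsAtom A := isSimpleModule_iff_isAtom.1 (IsSimpleModule.congr e)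
    have hB : IsAtom B := isSimpleModule_iff_isAtom.1 (IsSimpleModule.congr f)
    by_contra hne
    exact hN ⟨A, B, hA.1, hB.1, hA.disjoint_of_ne hB hne, ⟨e.trans f.symm⟩⟩
  unfold isotypicComponent
  rcases hsub.eq_empty_or_singleton with h | ⟨A, h⟩
  · rw [h, sSup_empty]
    infer_instance
  · rw [h, sSup_singleton]
    obtain ⟨e⟩ : Nonempty (A ≃ₗ[R] S) := h.ge rfl
    exact isNoetherian_of_linearEquiv e.symm

theorem Module.HasCyclicSocle.isNoetherian_isotypicComponent {N S : Type*} [AddCommGroup N]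
    [Module R N] [AddCommGroup S] [Module R S] [IsSimpleModule R S]
    (hN : Module.HasCyclicSocle R N) : IsNoetherian R (isotypicComponent R N S) := by
  have hle : isotypicComponent R N S ≤ Module.socle R N :=
    sSup_le_sSup fun A ⟨e⟩ ↦ IsSimpleModule.congr e
  have hss : IsSemisimpleModule R (Module.socle R N) := by
    rw [Module.socle, sSup_eq_iSup]
    exact isSemisimpleModule_biSup_of_isSemisimpleModule_submodule fun A (hA : IsSimpleModule R A) ↦
      inferInstance
  have hfin : Module.Finite R (Module.socle R N) := by
    obtain ⟨x, hx⟩ := hN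
    exact Module.Finite.iff_fg.2 ⟨{x}, by simpa using hx.symm⟩
  have : IsNoetherian R (Module.socle R N) := inferInstance
  exact isNoetherian_of_le hle

variable {E : Type*} [AddCommGroup E] [Module R E] {S : Type*} [AddCommGroup S] [Module R S]
  [IsSimpleModule R S]

/-- If finitely many summands received all nonzero maps from `S`, then an infinite direct sum of
copies of `S` would embed into the finite product of their `S`-isotypic components. -/
theorem DirectSum.IsInternal.infinite_setOf_exists_ne_zero {ι : Type*} [DecidableEq ι]
    {N : ι → Submodule R E} (hN : DirectSum.IsInternal N)
    (hS : ∀ i, IsNoetherian R (isotypicComponent R (N i) S))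
    (f : (ℕ →₀ S) →ₗ[R] E) (hf : Function.Injective f) :
    {i | ∃ g : S →ₗ[R] N i, g ≠ 0}.Infinite := by
  intro hfin
  let e := LinearEquiv.ofBijective (DirectSum.coeLinearMap N) hN
  let p : ∀ i, (ℕ →₀ S) →ₗ[R] N i := fun i ↦
    DirectSum.component R ι _ i ∘ₗ e.symm.toLinearMap ∘ₗ f
  have hp0 : ∀ i ∉ {i | ∃ g : S →ₗ[R] N i, g ≠ 0}, p i = 0 := fun i hi ↦ by
    refine Finsupp.lhom_ext' fun n ↦ ?_
    by_contra hne
    exact hi ⟨_, hne⟩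
  have hpS : ∀ i x, p i x ∈ isotypicComponent R (N i) S := fun i x ↦ by
    induction x using Finsupp.induction_linear with
    | zero => simp
    | add x y hx hy => rw [map_add]; exact add_mem hx hy
    | single n s =>
      have h := LinearMap.le_comap_isotypicComponent (S := S) (p i ∘ₗ Finsupp.lsingle n)
      have htop : isotypicComponent R S S = ⊤ :=
        top_le_iff.1 (le_sSup ⟨Submodule.topEquiv⟩)
      exact h (htop ▸ Submodule.mem_top)
  have := hfin.to_subtype
  let P : (ℕ →₀ S) →ₗ[R]
      ∀ i : {i | ∃ g : S →ₗ[R] N i, g ≠ 0}, isotypicComponent R (N i) S :=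
    LinearMap.pi fun i ↦ (p i).codRestrict _ (hpS i)
  have hP : Function.Injective P := by
    rw [injective_iff_map_eq_zero]
    intro x hx
    apply hf
    apply e.symm.injective
    rw [map_zero, map_zero]
    refine DFinsupp.ext fun i ↦ ?_
    by_cases hi : i ∈ {i | ∃ g : S →ₗ[R] N i, g ≠ 0}
    · exact congr_arg Subtype.val (congr_fun hx ⟨i, hi⟩)
    · exact congr($(hp0 i hi) x)
  have hnoeth : IsNoetherian R (ℕ →₀ S) := isNoetherian_of_injective P hP
  have := IsSimpleModule.nontrivial R S
  exact Infinite.not_finite (α := ℕ) <| WellFoundedGT.finite_of_iSupIndep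
    (iSupIndep_range_lsingle ℕ R S) fun n h ↦ by
      obtain ⟨s, hs⟩ := exists_ne (0 : S)
      have : Finsupp.single n s ∈ (⊥ : Submodule R (ℕ →₀ S)) := h ▸ ⟨s, rfl⟩
      simp [hs] at this

end Isotypic

/-! ### Injective modules force the ascending chain condition -/

section Chain

variable {R : Type*} [Ring R]

/-- A nonzero element of a module is detected by maps to injective modules that contain a suitable
simple module. -/
theorem Module.Baer.exists_isMaximal_forall_exists_apply_ne_zero {X : Type*} [AddCommGroup X]
    [Module R X] {x : X} (hx : x ≠ 0) :
    ∃ m : Ideal R, m.IsMaximal ∧ ∀ (Q : Type*) [AddCommGroup Q] [Module R Q],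
      Module.Baer R Q → ∀ g : (R ⧸ m) →ₗ[R] Q, g ≠ 0 → ∃ f : X →ₗ[R] Q, f x ≠ 0 := by
  let t := LinearMap.toSpanSingleton R X x
  have hker : LinearMap.ker t ≠ ⊤ := fun h ↦ hx <| by
    have : (1 : R) ∈ LinearMap.ker t := h ▸ Submodule.mem_top
    simpa [t] using this
  obtain ⟨m, hm, hle⟩ := Ideal.exists_le_maximal _ hker
  refine ⟨m, hm, fun Q _ _ hQ g hg ↦ ?_⟩
  obtain ⟨f, hf⟩ := hQ.extension_property ((LinearMap.ker t).liftQ t le_rfl)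
    (LinearMap.ker_eq_bot.1 (Submodule.ker_liftQ_eq_bot _ _ _ le_rfl))
    (g ∘ₗ Submodule.factor hle)
  refine ⟨f, fun h0 ↦ hg ?_⟩
  have h1 : f (t 1) = g (m.mkQ 1) := congr($hf ((LinearMap.ker t).mkQ 1))
  refine Submodule.linearMap_qext _ (LinearMap.ext_ring ?_)
  simpa [t, h0] using h1.symm

/-- A sequence of infinite sets has a system of distinct representatives, by Hall's theorem applied
to subsets of size `n + 1`. -/
theorem Set.exists_injective_forall_mem_of_infinite {α : Type*} {J : ℕ → Set α}
    (hJ : ∀ n, (J n).Infinite) : ∃ j : ℕ → α, Function.Injective j ∧ ∀ n, j n ∈ J n := by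
  classical
  choose T hTJ hT using fun n ↦ (hJ n).exists_subset_card_eq (n + 1)
  obtain ⟨j, hj, hjT⟩ := (Finset.all_card_le_biUnion_card_iff_exists_injective T).1 fun s ↦ by
    rcases s.eq_empty_or_nonempty with rfl | hs
    · simp
    · calc s.card ≤ (Finset.range (s.max' hs + 1)).card := Finset.card_le_card fun n hn ↦
            Finset.mem_range.2 (Nat.lt_succ_of_le (s.le_max' n hn))
        _ = (T (s.max' hs)).card := by rw [Finset.card_range, hT]
        _ ≤ _ := Finset.card_le_card (Finset.subset_biUnion_of_mem T (s.max'_mem hs))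
  exact ⟨j, hj, fun n ↦ hTJ n (hjT n)⟩

/-- If an injective direct sum receives, for every maximal left ideal `m`, nonzero maps from `R ⧸ m`
into infinitely many of its summands, then `R` is left Noetherian: a strictly ascending chain of
left ideals would yield a map from its union to the direct sum that does not extend to `R`. -/
theorem isNoetherianRing_of_infinite_setOf_exists_ne_zero {ι : Type*} {Q : ι → Type*}
    [∀ i, AddCommGroup (Q i)] [∀ i, Module R (Q i)] (hQ : Module.Baer R (Π₀ i, Q i))
    (h : ∀ m : Ideal R, m.IsMaximal → {i | ∃ g : (R ⧸ m) →ₗ[R] Q i, g ≠ 0}.Infinite) :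
    IsNoetherianRing R := by
  classical
  have hQi : ∀ i, Module.Baer R (Q i) := fun i ↦
    hQ.of_retract (DFinsupp.lsingle i) (DFinsupp.lapply i) fun x ↦ by simp
  rw [isNoetherianRing_iff, isNoetherian_iff, RelEmbedding.wellFounded_iff_isEmpty]
  refine ⟨fun I ↦ ?_⟩
  have hlt : ∀ {k n}, k < n → I k < I n := fun hkn ↦ I.map_rel_iff.2 hkn
  choose a ha haI using fun n ↦ SetLike.exists_of_lt (hlt (Nat.lt_succ_self n))
  have ha0 : ∀ n : ℕ, Submodule.mkQ (I n) (a n) ≠ 0 := fun n ↦ by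
    simpa [Submodule.Quotient.mk_eq_zero] using haI n
  choose m hm hf using fun n ↦
    Module.Baer.exists_isMaximal_forall_exists_apply_ne_zero (R := R) (ha0 n)
  obtain ⟨j, hj, hjm⟩ := Set.exists_injective_forall_mem_of_infinite fun n ↦ h (m n) (hm n)
  -- The `j n`-th component kills `I n` but not `a n`; components outside the range of `j` vanish.
  have hg : ∀ i, ∃ g : R →ₗ[R] Q i,
      (∀ n, j n = i → g (a n) ≠ 0 ∧ ∀ x ∈ I n, g x = 0) ∧ (i ∉ Set.range j → g = 0) := fun i ↦ by
    by_cases hi : i ∈ Set.range j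
    · obtain ⟨n, rfl⟩ := hi
      obtain ⟨g, hg⟩ := hjm n
      obtain ⟨f, hf⟩ := hf n (Q (j n)) (hQi _) g hg
      refine ⟨f ∘ₗ (I n).mkQ, fun k hk ↦ ?_, fun h ↦ absurd ⟨n, rfl⟩ h⟩
      obtain rfl := hj hk
      refine ⟨hf, fun x hx ↦ ?_⟩
      rw [LinearMap.comp_apply, Submodule.mkQ_apply, (Submodule.Quotient.mk_eq_zero _).2 hx,
        map_zero]
    · exact ⟨0, fun n hn ↦ absurd ⟨n, hn⟩ hi, fun _ ↦ rfl⟩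
  choose g hgj hg0 using hg
  have hmono : Monotone I := fun k n hkn ↦ hkn.eq_or_lt.elim (fun h ↦ h ▸ le_rfl) fun h ↦ (hlt h).le
  have hfin := hQ.finite_setOf_exists_ne_zero (⨆ n, I n) g fun x hx ↦ by
    obtain ⟨n, hn⟩ := (Submodule.mem_iSup_of_directed _ hmono.directed_le).1 hx
    refine ((Set.finite_lt_nat n).image j).subset fun i hi ↦ ?_
    obtain ⟨k, rfl⟩ : i ∈ Set.range j := by_contra fun h ↦ hi (by simp [hg0 i h])
    exact ⟨k, not_le.1 fun hnk ↦ hi ((hgj _ k rfl).2 x (hmono hnk hn)), rfl⟩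
  refine Set.infinite_range_of_injective hj (hfin.subset ?_)
  rintro _ ⟨n, rfl⟩
  exact ⟨a n, Submodule.mem_iSup_of_mem (n + 1) (ha n), (hgj _ n rfl).1⟩

end Chain

/-! ### The equivalence -/

/-- Every family of modules embeds memberwise into a single injective module. -/
theorem Module.exists_injective_forall_embedding (R : Type u) [Ring R] {κ : Type u} (X : κ → Type u)
    [∀ k, AddCommGroup (X k)] [∀ k, Module R (X k)] :
    ∃ (E : Type (max u v)) (_ : AddCommGroup E) (_ : Module R E),
      Module.Injective R E ∧ ∀ k, ∃ f : X k →ₗ[R] E, Function.Injective f := by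
  classical
  have := ModuleCat.enoughInjectives.{v} R
  obtain ⟨⟨J, hJ, f, hf⟩⟩ := CategoryTheory.EnoughInjectives.presentation
    (ModuleCat.of R (ULift.{v} (∀ k, X k)))
  exact ⟨J, inferInstance, inferInstance, (Module.injective_iff_injective_object R J).2 hJ,
    fun k ↦ ⟨f.hom ∘ₗ ULift.moduleEquiv.symm.toLinearMap ∘ₗ LinearMap.single R X k,
      ((ModuleCat.mono_iff_injective f).1 hf).comp
        (ULift.moduleEquiv.symm.injective.comp (Pi.single_injective k))⟩⟩

/-- The common half of the argument for square-free modules and for modules with cyclic socle: it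
suffices that all isotypic components of the summands are Noetherian. -/
theorem isNoetherianRing_of_isDirectSumOf (R : Type u) [Ring R]
    (P : ∀ (N : Type (max u v)) [AddCommGroup N] [Module R N], Prop)
    (hP : ∀ (N : Type (max u v)) [AddCommGroup N] [Module R N], P N →
      ∀ (S : Type u) [AddCommGroup S] [Module R S] [IsSimpleModule R S],
        IsNoetherian R (isotypicComponent R N S))
    (h : ∀ (M : Type (max u v)) [AddCommGroup M] [Module R M], Module.Injective R M →
      Module.IsDirectSumOf R P M) : IsNoetherianRing R := by
  classical
  -- An injective module containing countably many copies of each simple module.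
  obtain ⟨E, _, _, hE, hE'⟩ := Module.exists_injective_forall_embedding.{u, v} R
    fun m : {m : Ideal R // m.IsMaximal} ↦ ℕ →₀ R ⧸ m.1
  obtain ⟨ι, N, hN, hNP⟩ := h E hE
  have hB : Module.Baer R E := Module.Baer.of_injective hE
  refine isNoetherianRing_of_infinite_setOf_exists_ne_zero (Q := fun i ↦ N i)
    (hB.of_equiv (LinearEquiv.ofBijective (DirectSum.coeLinearMap N) hN).symm) fun m hm ↦ ?_
  have : IsSimpleModule R (R ⧸ m) := isSimpleModule_iff_isCoatom.2 hm.out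
  obtain ⟨f, hf⟩ := hE' ⟨m, hm⟩
  exact hN.infinite_setOf_exists_ne_zero (fun i ↦ hP _ (hNP i) _) f hf

/-- By Matlis' theorem, a property shared by all uniform modules yields direct sum decompositions of
injective modules over a left Noetherian ring. -/
theorem isDirectSumOf_of_isNoetherianRing (R : Type u) [Ring R] [IsNoetherianRing R]
    (P : ∀ (N : Type (max u v)) [AddCommGroup N] [Module R N], Prop)
    (M : Type (max u v)) [AddCommGroup M] [Module R M] (hM : Module.Injective R M)
    (hP : ∀ U : Submodule R M, U.IsUniform → P U) : Module.IsDirectSumOf R P M := by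
  obtain ⟨s, hs, htop, hU⟩ := (Module.Baer.of_injective hM).exists_sSupIndep_isUniform
  -- `Module.IsDirectSumOf` is stated with the classical decidability instance.
  let _ : DecidableEq s := fun a b ↦ Classical.propDecidable (a = b)
  exact ⟨s, (↑), DirectSum.isInternal_submodule_of_iSupIndep_of_iSup_eq_top
    ((sSupIndep_iff s).1 hs) (by rw [← sSup_eq_iSup', htop]), fun N ↦ hP N (hU N N.2)⟩

theorem mainTheorem6 (R : Type u) [Ring R] :
    List.TFAE [
      ∀ (M : Type (max u v)) [AddCommGroup M] [Module R M], Module.Injective R M →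
        Module.IsDirectSumOf R (fun N _ _ => Module.IsSquareFree R N) M,
      ∀ (M : Type (max u v)) [AddCommGroup M] [Module R M], Module.Injective R M →
        Module.IsDirectSumOf R (fun N _ _ => Module.HasCyclicSocle R N) M,
      IsNoetherianRing R] := by
  tfae_have 1 → 3 := isNoetherianRing_of_isDirectSumOf.{u, v} R _
    fun _ _ _ hN _ _ _ _ ↦ hN.isNoetherian_isotypicComponent
  tfae_have 2 → 3 := isNoetherianRing_of_isDirectSumOf.{u, v} R _
    fun _ _ _ hN _ _ _ _ ↦ hN.isNoetherian_isotypicComponent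
  tfae_have 3 → 1 := fun _ M _ _ hM ↦
    isDirectSumOf_of_isNoetherianRing.{u, v} R _ M hM fun _ hU ↦ hU.isSquareFree
  tfae_have 3 → 2 := fun _ M _ _ hM ↦
    isDirectSumOf_of_isNoetherianRing.{u, v} R _ M hM fun _ hU ↦ hU.hasCyclicSocle
  tfae_finish
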